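/- Work in $\mathbb R^3$ and write points of $T\mathbb R^3=\mathbb R^3\times\mathbb R^3$, with its product Euclidean structure, as $(m,\xi)$. For a compact convex set $C\subset\mathbb R^3$ let $$S(C)=\{(p,n): p\in\partial C,\ \|n\|=1,\ \langle n,x-p\rangle\le 0\ \text{for all } x\in C\}$$ be its set of unit normals, and let its normal cycle $N(C)$ be the $2$-current of integration over $S(C)$ with respect to the $2$-dimensional Hausdorff measure, where $S(C)$ is oriented so that a positive frame of a tangent plane at $(m,\xi)$ is sent by $(m,\xi)\mapsto m+t\xi$, $t>0$, to two vectors that form, followed by $\xi$, a direct frame of $\mathbb R^3$. The normal cycle of a union $C_1\cup\dots\cup C_n$ of compact convex sets is given by inclusion-exclusion: $$N(C_1\cup\dots\cup C_n)=\sum_{\emptyset\ne I\subset\{1,\dots,n\}}(-1)^{|I|+1}N\Big(\bigcap_{i\in I}C_i\Big).$$ For $X,Y\in\mathbb R^3$ consider the $2$-forms $$\omega^{X,Y}_{(m,\xi)}=(0,Y)^*\wedge(\xi\times X,0)^*,\qquad \widetilde\omega^{X,Y}_{(m,\xi)}=(X,0)^*\wedge(0,\xi\times Y)^*,\qquad u^*=\langle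 u,\cdot\rangle ,$$ and, for a Borel set $B\subset\mathbb R^3$ and such a union $\mathcal C$, the two anisotropic curvature measures of $\mathcal C$ above $B$, which are the bilinear forms $$\overline H_{\mathcal C}(B)(X,Y)=N(\mathcal C)\big(\mathbf 1_{B\times\mathbb R^3}\,\omega^{X,Y}\big),\qquad \overline{\widetilde H}_{\mathcal C}(B)(X,Y)=N(\mathcal C)\big(\mathbf 1_{B\times\mathbb R^3}\,\widetilde\omega^{X,Y}\big).$$ 1. Let $\mathbb B$ be a closed ball of radius $r>0$ and $B\subset\mathbb R^3$ a Borel set. Then both bilinear forms are given by the same $3\times3$ matrix $$\overline{\widetilde H}_{\mathbb B}(B)=\overline H_{\mathbb B}(B)=\int_{B\cap\partial\mathbb B}\frac1r\,\big(\mathrm{Id}-n_p\,{}^tn_p\big)\,dp,$$ where $n_p$ is the outer unit normal of $\mathbb B$ at $p$ and $dp$ is surface area. 2. Let $\mathbb B_1,\mathbb B_2,\mathbb B_3$ be closed balls of the same radius $r>0$ and let $p\in\partial\mathbb B_1\cap\partial\mathbb B_2\cap\partial\mathbb B_3$. Then $$\overline H_{\mathbb B_1\cup\mathbb B_2\cup\mathbb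 B_3}(\{p\})=0\qquad\text{and}\qquad\overline{\widetilde H}_{\mathbb B_1\cup\mathbb B_2\cup\mathbb B_3}(\{p\})=0 .$$ In both cases the measures are well defined: each of the sets $S(\cdot)$ entering the normal cycle has finite area above $B$ (respectively above $\{p\}$), and has a tangent plane with a positive frame at almost every point of that part. -/

import Mathlib

open MeasureTheory Set Metric
open scoped RealInnerProductSpace

noncomputable section

namespace NormalCycle

/-- Euclidean three-space (both the base `E` and the fibre `F` of the tangent bundle). -/
abbrev E3 : Type := EuclideanSpace ℝ (Fin 3)

/-- The total space `E × F` of the tangent bundle of `ℝ³`, with the dot product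
`⟨(e, f), (e', f')⟩ = ⟨e, e'⟩ + ⟨f, f'⟩`. -/
abbrev TE3 : Type := WithLp 2 (E3 × E3)

/-- The element `(m, ξ)` of `E × F`. -/
def pair (m ξ : E3) : TE3 := WithLp.toLp 2 (m, ξ)

/-- The cross product of `ℝ³`. -/
def cross (u v : E3) : E3 :=
  WithLp.toLp 2 (crossProduct (WithLp.ofLp u) (WithLp.ofLp v))

/-- Differential 2-forms on `E × F` (no regularity imposed). -/
abbrev Form2 : Type := TE3 → (TE3 [⋀^Fin 2]→ₗ[ℝ] ℝ)

/-- The 1-form `u^* : x ↦ ⟨u, x⟩`. -/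
def dual (u : TE3) : TE3 →ₗ[ℝ] ℝ := (innerSL ℝ u).toLinearMap

/-- The wedge product of two 1-forms, as an alternating 2-form. -/
def wedge (α β : TE3 →ₗ[ℝ] ℝ) : TE3 [⋀^Fin 2]→ₗ[ℝ] ℝ :=
  (Matrix.detRowAlternating (R := ℝ) (n := Fin 2)).compLinearMap (LinearMap.pi ![α, β])

theorem wedge_apply (α β : TE3 →ₗ[ℝ] ℝ) (τ : Fin 2 → TE3) :
    wedge α β τ = α (τ 0) * β (τ 1) - α (τ 1) * β (τ 0) := by
  change Matrix.det (Matrix.of fun i : Fin 2 => LinearMap.pi ![α, β] (τ i)) = _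
  rw [Matrix.det_fin_two]
  simp
  ring

/-- The set of unit normals `S(C) = {(p, n) : p ∈ ∂C, n ∈ CN_C(p)}` of a convex set `C`, where
`CN_C(p) = {n : ‖n‖ = 1 and ⟨n, x - p⟩ ≤ 0 for all x ∈ C}`. -/
def unitNormals (C : Set E3) : Set TE3 :=
  {z | z.fst ∈ frontier C ∧ ‖z.snd‖ = 1 ∧ ∀ x ∈ C, ⟪z.snd, x - z.fst⟫ ≤ 0}

/-- `τ` is a positively oriented orthonormal basis of the tangent plane of `S` at `z = (m, ξ)`.
The orientation is the one for which `(m, ξ) ↦ m + t ξ`, `t > 0`, sends `τ` to a pair of vectors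
that forms a direct frame with the outer normal `ξ`. (At almost every point of `unitNormals C`,
`C` compact and convex, the tangent cone is a plane and one of its two orientations satisfies the
last condition, simultaneously for all `t > 0`.) -/
def IsPositiveFrame (S : Set TE3) (z : TE3) (τ : Fin 2 → TE3) : Prop :=
  Orthonormal ℝ τ ∧
  (Submodule.span ℝ (range τ) : Set TE3) = tangentConeAt ℝ S z ∧
  ∀ t : ℝ, 0 < t →
    0 < ⟪cross ((τ 0).fst + t • (τ 0).snd) ((τ 1).fst + t • (τ 1).snd), z.snd⟫

open Classical in
/-- A positive orthonormal tangent frame of `S` at `z`, where there is one. It represents the unit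
2-vector `τ₀ ∧ τ₁` that orients `S`; the latter does not depend on the frame chosen. -/
def frame (S : Set TE3) (z : TE3) : Fin 2 → TE3 :=
  if h : ∃ τ, IsPositiveFrame S z τ then h.choose else 0

/-- The 2-current associated with the oriented set `S`: integration of `⟨τ₀ ∧ τ₁, φ⟩` with respect
to the two-dimensional Hausdorff measure (normalized to be area on planes). -/
def integrationCurrent (S : Set TE3) (φ : Form2) : ℝ :=
  ∫ z in S, φ z (frame S z) ∂μHE[2]

/-- The non-empty subsets of the index set of a finite family. -/
def nonemptySubsets (n : ℕ) : Finset (Finset (Fin n)) :=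
  {I : Finset (Fin n) | I.Nonempty}

/-- The normal cycle of the union of a finite family of compact convex sets, by
inclusion-exclusion. -/
def normalCycle {n : ℕ} (C : Fin n → Set E3) (φ : Form2) : ℝ :=
  ∑ I ∈ nonemptySubsets n,
    (-1) ^ (I.card + 1) * integrationCurrent (unitNormals (⋂ i ∈ I, C i)) φ

/-- The set `B × F`. -/
def above (B : Set E3) : Set TE3 := {z | z.fst ∈ B}

/-- The form `𝟏_{B × F} φ`. -/
def restrictForm (B : Set E3) (φ : Form2) : Form2 := (above B).indicator φ

/-- The form `ω^{X,Y} = (0, Y)^* ∧ (ξ × X, 0)^*` at `(m, ξ)`. -/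
def omega (X Y : E3) : Form2 := fun z =>
  wedge (dual (pair 0 Y)) (dual (pair (cross z.snd X) 0))

/-- The form `ω̃^{X,Y} = (X, 0)^* ∧ (0, ξ × Y)^*` at `(m, ξ)`. -/
def omegaTilde (X Y : E3) : Form2 := fun z =>
  wedge (dual (pair X 0)) (dual (pair 0 (cross z.snd Y)))

/-- The first anisotropic curvature measure of the union of the family `C`, above `B`, as a
bilinear form. -/
def anisotropicH {n : ℕ} (C : Fin n → Set E3) (B : Set E3) (X Y : E3) : ℝ :=
  normalCycle C (restrictForm B (omega X Y))

/-- The second anisotropic curvature measure of the union of the family `C`, above `B`, as a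
bilinear form. -/
def anisotropicHTilde {n : ℕ} (C : Fin n → Set E3) (B : Set E3) (X Y : E3) : ℝ :=
  normalCycle C (restrictForm B (omegaTilde X Y))

/-- Above `B`, the normal cycle of the family `C` is a genuine current of finite mass: the sets of
unit normals over which one integrates have finite area above `B`, and positive tangent frames at
almost all of their points above `B`. -/
def IsRepresentableAbove {n : ℕ} (C : Fin n → Set E3) (B : Set E3) : Prop :=
  ∀ I ∈ nonemptySubsets n,
    (μHE[2] : Measure TE3) (unitNormals (⋂ i ∈ I, C i) ∩ above B) < ⊤ ∧
    ∀ᵐ z ∂(μHE[2] : Measure TE3).restrict (unitNormals (⋂ i ∈ I, C i) ∩ above B),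
      ∃ τ, IsPositiveFrame (unitNormals (⋂ i ∈ I, C i)) z τ

/-- The outer unit normal at the point `p` of the sphere of centre `A` and radius `r`. -/
def ballNormal (A : E3) (r : ℝ) (p : E3) : E3 := r⁻¹ • (p - A)

/-- The matrix `∫_{B ∩ ∂𝔹} (1/r) (Id - n_p ᵗn_p) dp`, for the ball `𝔹` of centre `A` and radius
`r`, integrated entry by entry with respect to surface area. -/
def ballMatrix (A : E3) (r : ℝ) (B : Set E3) : Matrix (Fin 3) (Fin 3) ℝ :=
  Matrix.of fun i j => ∫ p in B ∩ frontier (closedBall A r),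
    ((1 / r) • ((1 : Matrix (Fin 3) (Fin 3) ℝ) -
      Matrix.vecMulVec (WithLp.ofLp (ballNormal A r p)) (WithLp.ofLp (ballNormal A r p)))) i j
    ∂(μHE[2] : Measure E3)

end NormalCycle

end

noncomputable section

namespace NormalCycle

/-! Everything rests on tangent planes of the form `{(a v, v) : v ⟂ ξ}`, with `a = r` on the normals
of a ball of radius `r` and `a = 0` on the normals based at one fixed point. For a positive
orthonormal frame of such a plane, the second components have cross product `ξ / (1 + a²)`. The
Binet-Cauchy identity then shows that both forms take the value `a / (1 + a²) * (⟪X, Y⟫ - ⟪X, ξ⟫ ⟪Y,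
ξ⟫)` (`omega_apply_positiveFrame`, `omegaTilde_apply_positiveFrame`).

For a ball, `p ↦ (p, n_p)` multiplies area by `1 + r⁻²`, which turns the factor `r / (1 + r²)` into
`1 / r`.

At a common boundary point `p`, the integrand vanishes for each intersection separately, so no
cancellation in the inclusion-exclusion sum is needed. What must be proved is that the tangent cone
is the plane with `a = 0` almost everywhere above `p`. If `ξ` is interior to the normal cone at `p`,
the unit normals near `(p, ξ)` are all based at `p`. The remaining directions lie on the boundary of
a convex cone, which is Lebesgue null and therefore meets the unit sphere in zero area
(`euclideanHausdorffMeasure_frontier_normalCone`). -/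

/-! ### Cross product identities -/

theorem inner_eq_sum_coords (u v : E3) : ⟪u, v⟫ = u 0 * v 0 + u 1 * v 1 + u 2 * v 2 := by
  simp [PiLp.inner_apply, Fin.sum_univ_three, mul_comm]

theorem cross_apply_zero (u v : E3) : cross u v 0 = u 1 * v 2 - u 2 * v 1 := by
  simp [cross, cross_apply]

theorem cross_apply_one (u v : E3) : cross u v 1 = u 2 * v 0 - u 0 * v 2 := by
  simp [cross, cross_apply]

theorem cross_apply_two (u v : E3) : cross u v 2 = u 0 * v 1 - u 1 * v 0 := by
  simp [cross, cross_apply]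

theorem inner_cross_cross (a b c d : E3) :
    ⟪cross a b, cross c d⟫ = ⟪a, c⟫ * ⟪b, d⟫ - ⟪a, d⟫ * ⟪b, c⟫ := by
  simp only [inner_eq_sum_coords, cross_apply_zero, cross_apply_one, cross_apply_two]
  ring

theorem cross_cross_right (u v w : E3) : cross u (cross v w) = ⟪u, w⟫ • v - ⟪u, v⟫ • w := by
  ext i
  fin_cases i <;>
    simp [inner_eq_sum_coords, cross_apply_zero, cross_apply_one, cross_apply_two] <;> ring

theorem cross_cross_left (u v w : E3) : cross (cross u v) w = ⟪u, w⟫ • v - ⟪v, w⟫ • u := by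
  ext i
  fin_cases i <;>
    simp [inner_eq_sum_coords, cross_apply_zero, cross_apply_one, cross_apply_two] <;> ring

theorem inner_cross_self_left (u v : E3) : ⟪cross u v, u⟫ = 0 := by
  simp only [inner_eq_sum_coords, cross_apply_zero, cross_apply_one, cross_apply_two]
  ring

theorem inner_cross_self_right (u v : E3) : ⟪cross u v, v⟫ = 0 := by
  simp only [inner_eq_sum_coords, cross_apply_zero, cross_apply_one, cross_apply_two]
  ring

theorem cross_smul_smul (s t : ℝ) (u v : E3) : cross (s • u) (t • v) = (s * t) • cross u v := by
  ext i
  fin_cases i <;>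
    simp [cross_apply_zero, cross_apply_one, cross_apply_two] <;> ring

/-! ### Positive frames of the model planes and values of the two forms -/

/-- The image of `ξ^⊥` under `v ↦ (a v, v)`. -/
def sheetTangent (a : ℝ) (ξ : E3) : Submodule ℝ TE3 where
  carrier := {y | y.fst = a • y.snd ∧ ⟪y.snd, ξ⟫ = 0}
  add_mem' := by
    rintro x y ⟨h1, h2⟩ ⟨h3, h4⟩
    refine ⟨?_, ?_⟩
    · simp [h1, h3]
    · simp [inner_add_left, h2, h4]
  zero_mem' := by simp
  smul_mem' := by
    rintro c x ⟨h1, h2⟩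
    refine ⟨?_, ?_⟩
    · simp [h1, smul_comm c a]
    · simp [inner_smul_left, h2]

theorem mem_sheetTangent {a : ℝ} {ξ : E3} {y : TE3} :
    y ∈ sheetTangent a ξ ↔ y.fst = a • y.snd ∧ ⟪y.snd, ξ⟫ = 0 := Iff.rfl

theorem inner_of_fst_eq_smul {a : ℝ} {x y : TE3} (hx : x.fst = a • x.snd)
    (hy : y.fst = a • y.snd) : ⟪x, y⟫ = (1 + a ^ 2) * ⟪x.snd, y.snd⟫ := by
  rw [WithLp.prod_inner_apply]
  change ⟪x.fst, y.fst⟫ + ⟪x.snd, y.snd⟫ = _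
  rw [hx, hy, real_inner_smul_left, real_inner_smul_right]
  ring

theorem exists_orthonormal_cross_eq {ξ : E3} (hξ : ‖ξ‖ = 1) :
    ∃ u v : E3, ⟪u, u⟫ = 1 ∧ ⟪v, v⟫ = 1 ∧ ⟪u, v⟫ = 0 ∧ ⟪u, ξ⟫ = 0 ∧ ⟪v, ξ⟫ = 0 ∧
      cross u v = ξ := by
  obtain ⟨u, hu, huξ⟩ : ∃ u : E3, ⟪u, u⟫ = 1 ∧ ⟪u, ξ⟫ = 0 := by
    obtain ⟨w, hw, hw0⟩ : ∃ w ∈ (ℝ ∙ ξ)ᗮ, w ≠ 0 := by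
      apply Submodule.exists_mem_ne_zero_of_ne_bot
      intro h
      have h1 := (ℝ ∙ ξ).finrank_add_finrank_orthogonal
      rw [h, finrank_bot, finrank_euclideanSpace_fin] at h1
      have := finrank_span_le_card (R := ℝ) ({ξ} : Set E3)
      simp at this
      omega
    refine ⟨‖w‖⁻¹ • w, ?_, ?_⟩
    · rw [real_inner_self_eq_norm_sq, norm_smul, norm_inv, norm_norm,
        inv_mul_cancel₀ (norm_ne_zero_iff.2 hw0), one_pow]
    · rw [real_inner_smul_left, real_inner_comm,
        Submodule.mem_orthogonal_singleton_iff_inner_right.1 hw, mul_zero]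
  have hξξ : ⟪ξ, ξ⟫ = 1 := by rw [real_inner_self_eq_norm_sq, hξ, one_pow]
  refine ⟨u, cross ξ u, hu, ?_, ?_, huξ, inner_cross_self_left _ _, ?_⟩
  · rw [inner_cross_cross, hu, hξξ, huξ]; simp
  · rw [real_inner_comm, inner_cross_self_right]
  · rw [cross_cross_right, hu, huξ]; simp

/-- On `ξ^⊥` the map `cross ξ` squares to `-1`, and `ξ × w` expands along `u` and `v` by the double
cross product identity. -/
theorem eq_add_of_inner_cross_eq_zero {u v w ξ : E3} (hξ : ‖ξ‖ = 1) (hu : ⟪u, u⟫ = 1)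
    (hv : ⟪v, v⟫ = 1) (huv : ⟪u, v⟫ = 0) (huvξ : cross u v = ξ) (hw : ⟪w, ξ⟫ = 0) :
    w = ⟪u, w⟫ • u + ⟪v, w⟫ • v := by
  have hξξ : ⟪ξ, ξ⟫ = 1 := by rw [real_inner_self_eq_norm_sq, hξ, one_pow]
  have h1 : cross ξ (cross ξ w) = -w := by
    rw [cross_cross_right, hξξ, real_inner_comm, hw]; simp
  have h2 : cross ξ w = ⟪u, w⟫ • v - ⟪v, w⟫ • u := by rw [← huvξ, cross_cross_left]
  have h3 : cross ξ (⟪u, w⟫ • v - ⟪v, w⟫ • u) = ⟪u, w⟫ • cross ξ v - ⟪v, w⟫ • cross ξ u := by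
    ext i
    fin_cases i <;> simp [cross_apply_zero, cross_apply_one, cross_apply_two] <;> ring
  have h4 : cross ξ v = -u := by
    rw [← huvξ, cross_cross_left, huv, hv]; simp
  have h5 : cross ξ u = v := by
    rw [← huvξ, cross_cross_left, hu, real_inner_comm, huv]; simp
  rw [h2, h3, h4, h5] at h1
  rw [← neg_inj, ← h1]
  simp [sub_eq_add_neg, add_comm]

theorem exists_isPositiveFrame {S : Set TE3} {z : TE3} {a : ℝ} (ha : 0 ≤ a) (hz : ‖z.snd‖ = 1)
    (hS : tangentConeAt ℝ S z = sheetTangent a z.snd) : ∃ τ, IsPositiveFrame S z τ := by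
  obtain ⟨u, v, hu, hv, huv, huξ, hvξ, hcr⟩ := exists_orthonormal_cross_eq hz
  have ha' : (0 : ℝ) < 1 + a ^ 2 := by positivity
  -- The length of `(a u, u)` is `√(1 + a²)` for a unit vector `u`; `c` normalizes it.
  set c : ℝ := (√(1 + a ^ 2))⁻¹ with hc
  have hcpos : 0 < c := by positivity
  have hc2 : (1 + a ^ 2) * (c * c) = 1 := by
    rw [hc, ← mul_inv, Real.mul_self_sqrt ha'.le, mul_inv_cancel₀ ha'.ne']
  let P : E3 → TE3 := fun w => pair (a • w) w
  have hP1 : ∀ w, (P w).fst = a • (P w).snd := fun w => rfl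
  have hP2 : ∀ w, (P w).snd = w := fun w => rfl
  have hPP : ∀ w w', ⟪P (c • w), P (c • w')⟫ = ⟪w, w'⟫ := by
    intro w w'
    rw [inner_of_fst_eq_smul (hP1 _) (hP1 _), hP2, hP2, real_inner_smul_left,
      real_inner_smul_right, ← mul_assoc c, ← mul_assoc, hc2, one_mul]
  refine ⟨![P (c • u), P (c • v)], ?_, ?_, ?_⟩
  · rw [orthonormal_iff_ite]
    intro i j
    fin_cases i <;> fin_cases j
    · exact (hPP u u).trans hu
    · exact (hPP u v).trans huv
    · exact (hPP v u).trans ((real_inner_comm _ _).trans huv)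
    · exact (hPP v v).trans hv
  · rw [hS, Matrix.range_cons, Matrix.range_cons, Matrix.range_empty, union_empty,
      singleton_union, SetLike.coe_set_eq]
    apply le_antisymm
    · rw [Submodule.span_le]
      rintro y (rfl | rfl)
      · exact mem_sheetTangent.2 ⟨hP1 _, by rw [hP2, real_inner_smul_left, huξ, mul_zero]⟩
      · exact mem_sheetTangent.2 ⟨hP1 _, by rw [hP2, real_inner_smul_left, hvξ, mul_zero]⟩
    · intro y hy
      obtain ⟨hy1, hy2⟩ := mem_sheetTangent.1 hy
      rw [Submodule.mem_span_pair]
      refine ⟨⟪u, y.snd⟫ * c⁻¹, ⟪v, y.snd⟫ * c⁻¹, ?_⟩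
      have h := eq_add_of_inner_cross_eq_zero hz hu hv huv hcr hy2
      have h2 : (⟪u, y.snd⟫ * c⁻¹) • c • u + (⟪v, y.snd⟫ * c⁻¹) • c • v = y.snd := by
        rw [smul_smul, smul_smul, inv_mul_cancel_right₀ hcpos.ne',
          inv_mul_cancel_right₀ hcpos.ne', ← h]
      refine (WithLp.ofLp_injective 2) (Prod.ext ?_ ?_)
      · change (⟪u, y.snd⟫ * c⁻¹) • a • c • u + (⟪v, y.snd⟫ * c⁻¹) • a • c • v = y.fst
        rw [hy1, smul_comm _ a, smul_comm _ a (c • v), ← smul_add, h2]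
      · exact h2
  · intro t ht
    change 0 < ⟪cross (a • c • u + t • c • u) (a • c • v + t • c • v), z.snd⟫
    rw [← add_smul, ← add_smul, smul_smul, smul_smul, cross_smul_smul, hcr, real_inner_smul_left,
      real_inner_self_eq_norm_sq, hz]
    positivity

theorem IsPositiveFrame.cross_snd {S : Set TE3} {z : TE3} {a : ℝ} (ha : 0 ≤ a) (hz : ‖z.snd‖ = 1)
    (hS : tangentConeAt ℝ S z = sheetTangent a z.snd) {τ : Fin 2 → TE3}
    (hτ : IsPositiveFrame S z τ) :
    (∀ i, (τ i).fst = a • (τ i).snd) ∧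
      cross (τ 0).snd (τ 1).snd = (1 + a ^ 2)⁻¹ • z.snd := by
  obtain ⟨hon, hsp, hpos⟩ := hτ
  have hmem : ∀ i, τ i ∈ sheetTangent a z.snd := by
    intro i
    have : τ i ∈ (Submodule.span ℝ (range τ) : Set TE3) :=
      Submodule.subset_span (mem_range_self i)
    rw [hsp, hS] at this
    exact this
  have h1 := fun i => (mem_sheetTangent.1 (hmem i)).1
  have h2 := fun i => (mem_sheetTangent.1 (hmem i)).2
  refine ⟨h1, ?_⟩
  have ha' : (0 : ℝ) < 1 + a ^ 2 := by positivity
  have hin : ∀ i j, (1 + a ^ 2) * ⟪(τ i).snd, (τ j).snd⟫ = if i = j then 1 else 0 := by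
    intro i j
    rw [← inner_of_fst_eq_smul (h1 i) (h1 j), orthonormal_iff_ite.1 hon]
  have h00 := hin 0 0
  have h11 := hin 1 1
  have h01 := hin 0 1
  simp only [if_true, Fin.zero_eq_one_iff, OfNat.ofNat_ne_one, if_false] at h00 h11 h01
  have h01' : ⟪(τ 0).snd, (τ 1).snd⟫ = 0 := by
    simpa [ha'.ne'] using h01
  have h00' : ⟪(τ 0).snd, (τ 0).snd⟫ = (1 + a ^ 2)⁻¹ := eq_inv_of_mul_eq_one_right h00
  have h11' : ⟪(τ 1).snd, (τ 1).snd⟫ = (1 + a ^ 2)⁻¹ := eq_inv_of_mul_eq_one_right h11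
  set w := cross (τ 0).snd (τ 1).snd with hw
  have hzz : ⟪z.snd, z.snd⟫ = 1 := by rw [real_inner_self_eq_norm_sq, hz, one_pow]
  have hzw : cross z.snd w = 0 := by
    rw [hw, cross_cross_right, real_inner_comm, h2 1, real_inner_comm, h2 0]; simp
  have hww : w = ⟪z.snd, w⟫ • z.snd := by
    have h := cross_cross_right z.snd z.snd w
    rw [hzw, hzz, one_smul] at h
    have h0 : cross z.snd 0 = 0 := by
      ext i
      fin_cases i <;> simp [cross_apply_zero, cross_apply_one, cross_apply_two]
    rw [h0] at h
    exact (sub_eq_zero.1 h.symm).symm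
  have hsq : ⟪w, w⟫ = (1 + a ^ 2)⁻¹ ^ 2 := by
    rw [hw, inner_cross_cross, h00', h11', h01']; ring
  have hs : ⟪z.snd, w⟫ ^ 2 = (1 + a ^ 2)⁻¹ ^ 2 := by
    rw [← hsq]
    conv_rhs => rw [hww]
    rw [real_inner_smul_left, real_inner_smul_right, hzz]; ring
  -- The Gram matrix fixes `w` only up to sign; the orientation condition, used at `t = 1`, decides
  -- it.
  have hspos : 0 < ⟪z.snd, w⟫ := by
    have h := hpos 1 one_pos
    rw [h1 0, h1 1, ← add_smul, ← add_smul, cross_smul_smul, real_inner_smul_left, ← hw,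
      real_inner_comm] at h
    exact pos_of_mul_pos_right h (by positivity)
  rw [hww, (pow_left_inj₀ hspos.le (by positivity) two_ne_zero).1 hs]

theorem dual_pair_apply (m ξ : E3) (y : TE3) : dual (pair m ξ) y = ⟪m, y.fst⟫ + ⟪ξ, y.snd⟫ := by
  simp [dual, pair, WithLp.prod_inner_apply]

theorem omega_apply_positiveFrame {S : Set TE3} {z : TE3} {a : ℝ} (ha : 0 ≤ a)
    (hz : ‖z.snd‖ = 1) (hS : tangentConeAt ℝ S z = sheetTangent a z.snd) {τ : Fin 2 → TE3}
    (hτ : IsPositiveFrame S z τ) (X Y : E3) :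
    omega X Y z τ = a * (1 + a ^ 2)⁻¹ * (⟪X, Y⟫ - ⟪X, z.snd⟫ * ⟪Y, z.snd⟫) := by
  obtain ⟨h1, h2⟩ := hτ.cross_snd ha hz hS
  have hzz : ⟪z.snd, z.snd⟫ = 1 := by rw [real_inner_self_eq_norm_sq, hz, one_pow]
  have h := inner_cross_cross Y (cross z.snd X) (τ 0).snd (τ 1).snd
  rw [h2, cross_cross_right, real_inner_smul_right, inner_sub_left, real_inner_smul_left,
    real_inner_smul_left, hzz, real_inner_comm X Y] at h
  rw [omega, wedge_apply]
  simp only [dual_pair_apply, h1, inner_zero_left, real_inner_smul_right]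
  linear_combination (-a) * h

/-- Both forms pair one base component with one fibre component, and the factor `a` can be moved
from one to the other. The later value is symmetric in `X` and `Y`, so the swap is harmless. -/
theorem omegaTilde_apply (X Y : E3) (z : TE3) (τ : Fin 2 → TE3) (a : ℝ)
    (h : ∀ i, (τ i).fst = a • (τ i).snd) : omegaTilde X Y z τ = omega Y X z τ := by
  simp only [omega, omegaTilde, wedge_apply, dual_pair_apply, h, inner_zero_left,
    real_inner_smul_right]
  ring

theorem omegaTilde_apply_positiveFrame {S : Set TE3} {z : TE3} {a : ℝ} (ha : 0 ≤ a)
    (hz : ‖z.snd‖ = 1) (hS : tangentConeAt ℝ S z = sheetTangent a z.snd) {τ : Fin 2 → TE3}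
    (hτ : IsPositiveFrame S z τ) (X Y : E3) :
    omegaTilde X Y z τ = a * (1 + a ^ 2)⁻¹ * (⟪X, Y⟫ - ⟪X, z.snd⟫ * ⟪Y, z.snd⟫) := by
  rw [omegaTilde_apply X Y z τ a (hτ.cross_snd ha hz hS).1,
    omega_apply_positiveFrame ha hz hS hτ, real_inner_comm]
  ring

theorem isPositiveFrame_frame {S : Set TE3} {z : TE3} (h : ∃ τ, IsPositiveFrame S z τ) :
    IsPositiveFrame S z (frame S z) := by
  rw [frame, dif_pos h]
  exact h.choose_spec

/-! ### Tangent cones of the sets of unit normals -/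

/-- The set of `(A + a ξ, ξ)` for `ξ` in the unit sphere. -/
def sheet (A : E3) (a : ℝ) : Set TE3 := {z | z.fst = A + a • z.snd ∧ ‖z.snd‖ = 1}

/-- The linear map `v ↦ (a v, v)`. -/
def sheetMap (a : ℝ) : E3 →L[ℝ] TE3 :=
  (WithLp.prodContinuousLinearEquiv 2 ℝ E3 E3).symm.toContinuousLinearMap ∘L
    ((a • ContinuousLinearMap.id ℝ E3).prod (ContinuousLinearMap.id ℝ E3))

/-- The derivative sends the tangent cone of `s` into that of `g '' s`, a set with at most one point
and hence without accumulation points. -/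
theorem tangentConeAt_subset_ker {E F : Type*} [NormedAddCommGroup E] [NormedSpace ℝ E]
    [NormedAddCommGroup F] [NormedSpace ℝ F] {s : Set E} {x : E} {g : E → F} {g' : E →L[ℝ] F}
    (hg : HasFDerivAt g g' x) {c : F} (hs : ∀ y ∈ s, g y = c) {y : E}
    (hy : y ∈ tangentConeAt ℝ s x) : g' y = 0 := by
  have h := hg.hasFDerivWithinAt.mapsTo_tangent_cone hy
  have h1 : tangentConeAt ℝ (g '' s) (g x) ⊆ {0} := by
    refine tangentConeAt_subset_zero ?_
    intro hacc
    have hsub : g '' s ⊆ {c} := by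
      rintro _ ⟨w, hw, rfl⟩
      exact hs w hw
    have := hacc.mono (Filter.principal_mono.2 hsub)
    rw [accPt_iff_clusterPt] at this
    by_cases hx : g x = c
    · rw [hx] at this
      have h2 := this.mono (Filter.inf_principal.le.trans
        (Filter.principal_mono.2 (by simp : {c}ᶜ ∩ {c} ⊆ (∅ : Set F))))
      simp [ClusterPt] at h2
      exact h2.ne rfl
    · have h2 := this.mono inf_le_right
      rw [← mem_closure_iff_clusterPt, closure_singleton] at h2
      exact hx h2
  exact h1 h

theorem tangentConeAt_sheet {A : E3} {a : ℝ} {z : TE3} (hz : z ∈ sheet A a) :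
    tangentConeAt ℝ (sheet A a) z = sheetTangent a z.snd := by
  let p1 : TE3 →L[ℝ] E3 := WithLp.fstL 2 ℝ E3 E3
  let p2 : TE3 →L[ℝ] E3 := WithLp.sndL 2 ℝ E3 E3
  apply Subset.antisymm
  · intro y hy
    refine mem_sheetTangent.2 ⟨?_, ?_⟩
    · have h := tangentConeAt_subset_ker (p1 - a • p2).hasFDerivAt (c := A)
        (fun w hw => sub_eq_iff_eq_add.2 hw.1) hy
      exact sub_eq_zero.1 h
    · have h := tangentConeAt_subset_ker (p2.hasFDerivAt.norm_sq (x := z)) (c := 1)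
        (fun w hw => by change ‖w.snd‖ ^ 2 = 1; rw [hw.2, one_pow]) hy
      have h' : ⟪p2 z, p2 y⟫ = 0 := by simpa using h
      rw [real_inner_comm]
      exact h'
  · intro y hy
    obtain ⟨hy1, hy2⟩ := mem_sheetTangent.1 hy
    set c : ℝ := ‖y.snd‖ ^ 2 with hc
    -- A curve on the unit sphere through `z.snd` with velocity `y.snd`. Orthogonality gives `‖z.snd
    -- + t y.snd‖² = 1 + c t²`, whence the normalization.
    let η : ℝ → E3 := fun t => (√(1 + c * t ^ 2))⁻¹ • (z.snd + t • y.snd)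
    have hpos : ∀ t : ℝ, 0 < 1 + c * t ^ 2 := fun t => by positivity
    have hη : HasDerivAt η y.snd 0 := by
      have h1 : HasDerivAt (fun t : ℝ => 1 + c * t ^ 2) 0 0 := by
        have := ((hasDerivAt_pow 2 (0 : ℝ)).const_mul c).const_add 1
        simpa using this
      have h2 := (h1.sqrt (hpos 0).ne').inv (Real.sqrt_pos.2 (hpos 0)).ne'
      have h3 : HasDerivAt (fun t : ℝ => z.snd + t • y.snd) y.snd 0 := by
        have := ((hasDerivAt_id (0 : ℝ)).smul_const y.snd).const_add z.snd
        simpa using this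
      exact (h2.smul h3).congr_deriv (by simp)
    have hη1 : ∀ t, ‖η t‖ = 1 := by
      intro t
      have h1 : ‖z.snd + t • y.snd‖ ^ 2 = 1 + c * t ^ 2 := by
        rw [norm_add_sq_real, hz.2, real_inner_smul_right, real_inner_comm, hy2, norm_smul,
          mul_pow, Real.norm_eq_abs, sq_abs, hc]
        ring
      rw [norm_smul, norm_inv, Real.norm_of_nonneg (Real.sqrt_nonneg _), ← h1,
        Real.sqrt_sq (norm_nonneg _), inv_mul_cancel₀]
      intro h0
      have := hpos t
      rw [← h1, h0] at this
      simp at this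
    have hM : HasFDerivAt (fun v => pair A 0 + sheetMap a v) (sheetMap a) (η 0) :=
      (sheetMap a).hasFDerivAt.const_add (pair A 0)
    have hmaps := (hM.comp (0 : ℝ) hη.hasFDerivAt).hasFDerivWithinAt (s := univ)
      |>.mapsTo_tangent_cone
    rw [tangentConeAt_univ] at hmaps
    have h := hmaps (mem_univ (1 : ℝ))
    have hη0 : η 0 = z.snd := by simp [η]
    have hz0 : pair A 0 + sheetMap a (η 0) = z := by
      rw [hη0]
      exact WithLp.ofLp_injective 2 (Prod.ext hz.1.symm (zero_add _))
    have hy' : (sheetMap a ∘L ContinuousLinearMap.toSpanSingleton ℝ y.snd) 1 = y := by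
      rw [ContinuousLinearMap.comp_apply, ContinuousLinearMap.toSpanSingleton_apply, one_smul]
      exact WithLp.ofLp_injective 2 (Prod.ext hy1.symm rfl)
    rw [Function.comp_apply, hz0, hy'] at h
    refine tangentConeAt_mono ?_ h
    rintro _ ⟨t, -, rfl⟩
    refine ⟨?_, ?_⟩
    · change A + a • η t = A + a • (0 + η t)
      rw [zero_add]
    · change ‖0 + η t‖ = 1
      rw [zero_add, hη1]

theorem unitNormals_closedBall {A : E3} {r : ℝ} (hr : 0 < r) :
    unitNormals (closedBall A r) = sheet A r := by
  ext z
  rw [unitNormals, mem_ofPred_eq, frontier_closedBall A hr.ne', mem_sphere_iff_norm, sheet,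
    mem_ofPred_eq]
  constructor
  · rintro ⟨h1, h2, h3⟩
    refine ⟨?_, h2⟩
    -- Testing normality at the point of the ball farthest in direction `z.snd` forces equality in
    -- Cauchy-Schwarz.
    have h4 := h3 (A + r • z.snd) (by
      rw [mem_closedBall_iff_norm, add_sub_cancel_left, norm_smul, h2, Real.norm_of_nonneg hr.le,
        mul_one])
    have h5 : r ≤ ⟪z.snd, z.fst - A⟫ := by
      have : A + r • z.snd - z.fst = r • z.snd - (z.fst - A) := by abel
      rw [this, inner_sub_right, real_inner_smul_right, real_inner_self_eq_norm_sq, h2] at h4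
      linarith
    have h6 : ‖(z.fst - A) - r • z.snd‖ ^ 2 ≤ 0 := by
      rw [norm_sub_sq_real, h1, norm_smul, h2, Real.norm_of_nonneg hr.le, real_inner_smul_right,
        real_inner_comm]
      nlinarith
    have h7 : (z.fst - A) - r • z.snd = 0 := by
      rw [← norm_eq_zero, ← sq_eq_zero_iff]
      exact le_antisymm h6 (sq_nonneg _)
    rw [← sub_eq_zero.1 h7]
    abel
  · rintro ⟨h1, h2⟩
    refine ⟨?_, h2, ?_⟩
    · rw [h1, add_sub_cancel_left, norm_smul, h2, Real.norm_of_nonneg hr.le, mul_one]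
    · intro x hx
      have h3 : x - z.fst = (x - A) - r • z.snd := by rw [h1]; abel
      rw [h3, inner_sub_right, real_inner_smul_right, real_inner_self_eq_norm_sq, h2]
      have h4 := real_inner_le_norm z.snd (x - A)
      rw [h2, one_mul] at h4
      linarith [mem_closedBall_iff_norm.1 hx]

/-- The normal cone of `C` at `p`. -/
def normalCone (C : Set E3) (p : E3) : Set E3 := {ξ | ∀ x ∈ C, ⟪ξ, x - p⟫ ≤ 0}

/-- If `n` is normal at `q` and interior to the normal cone at `p`, then `⟪n, q - p⟫ ≥ 0`, while `n
+ t (q - p)` is still normal at `p` for small `t > 0`. Hence `⟪n, q - p⟫ + t ‖q - p‖² ≤ 0`, and `q =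
p`. -/
theorem unitNormals_inter_interior_normalCone {C : Set E3} (hC : IsClosed C) {p : E3}
    (hp : p ∈ frontier C) :
    unitNormals C ∩ {z | z.snd ∈ interior (normalCone C p)} =
      sheet p 0 ∩ {z | z.snd ∈ interior (normalCone C p)} := by
  ext z
  refine and_congr_left fun hz => ?_
  have hz : z.snd ∈ interior (normalCone C p) := hz
  have hzK := interior_subset hz
  constructor
  · rintro ⟨h1, h2, h3⟩
    refine ⟨?_, h2⟩
    rw [zero_smul, add_zero]
    have hqC : z.fst ∈ C := hC.frontier_subset h1
    have hin : 0 ≤ ⟪z.snd, z.fst - p⟫ := by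
      have := h3 p (hC.frontier_subset hp)
      rw [← neg_sub, inner_neg_right] at this
      linarith
    have hcont : Filter.Tendsto (fun t : ℝ => z.snd + t • (z.fst - p)) (nhdsWithin 0 (Ioi 0))
        (nhds z.snd) := by
      have : Continuous fun t : ℝ => z.snd + t • (z.fst - p) := by fun_prop
      have h := this.tendsto 0
      rw [zero_smul, add_zero] at h
      exact h.mono_left nhdsWithin_le_nhds
    obtain ⟨t, ht, ht0⟩ := ((hcont.eventually (mem_interior_iff_mem_nhds.1 hz)).and
      self_mem_nhdsWithin).exists
    have ht0 : 0 < t := ht0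
    have h4 := ht _ hqC
    rw [inner_add_left, real_inner_smul_left] at h4
    have h5 : ⟪z.fst - p, z.fst - p⟫ ≤ 0 := by
      by_contra! h
      nlinarith [mul_pos ht0 h]
    exact sub_eq_zero.1 (inner_self_eq_zero.1 (le_antisymm h5 real_inner_self_nonneg))
  · rintro ⟨h1, h2⟩
    rw [zero_smul, add_zero] at h1
    refine ⟨h1 ▸ hp, h2, ?_⟩
    rw [h1]
    exact hzK

theorem tangentConeAt_unitNormals_of_mem_interior {C : Set E3} (hC : IsClosed C) {p : E3}
    (hp : p ∈ frontier C) {z : TE3} (hz : z ∈ unitNormals C)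
    (hz' : z.snd ∈ interior (normalCone C p)) :
    tangentConeAt ℝ (unitNormals C) z = sheetTangent 0 z.snd := by
  have hU : {w : TE3 | w.snd ∈ interior (normalCone C p)} ∈ nhds z :=
    (isOpen_interior.preimage (WithLp.sndL 2 ℝ E3 E3).continuous).mem_nhds hz'
  have hz2 : z ∈ sheet p 0 ∩ {w : TE3 | w.snd ∈ interior (normalCone C p)} := by
    rw [← unitNormals_inter_interior_normalCone hC hp]
    exact ⟨hz, hz'⟩
  rw [← tangentConeAt_inter_nhds hU, unitNormals_inter_interior_normalCone hC hp,
    tangentConeAt_inter_nhds hU, tangentConeAt_sheet hz2.1]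

/-! ### Hausdorff measure: Lipschitz maps, similarities, area on the unit sphere -/

theorem euclideanHausdorffMeasure_image_le {X Y : Type*} [MetricSpace X] [MeasurableSpace X]
    [BorelSpace X] [MetricSpace Y] [MeasurableSpace Y] [BorelSpace Y] {K : NNReal} {f : X → Y}
    {s : Set X} (h : LipschitzOnWith K f s) (d : ℕ) :
    μHE[d] (f '' s) ≤ (K : ENNReal) ^ d * μHE[d] s := by
  have h1 := h.hausdorffMeasure_image_le (d := d) (Nat.cast_nonneg d)
  rw [ENNReal.rpow_natCast] at h1
  simp_rw [Measure.euclideanHausdorffMeasure_def, Measure.smul_apply, ENNReal.smul_def,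
    smul_eq_mul]
  rw [mul_left_comm]
  gcongr

theorem euclideanHausdorffMeasure_image_of_dist_eq {X Y : Type*} [MetricSpace X]
    [MeasurableSpace X] [BorelSpace X] [MetricSpace Y] [MeasurableSpace Y] [BorelSpace Y]
    {k : NNReal} (hk : k ≠ 0) {f : X → Y} (h : ∀ x y, dist (f x) (f y) = k * dist x y) (d : ℕ)
    (s : Set X) : μHE[d] (f '' s) = (k : ENNReal) ^ d * μHE[d] s := by
  refine le_antisymm (euclideanHausdorffMeasure_image_le
    (LipschitzWith.of_dist_le_mul fun x y => (h x y).le).lipschitzOnWith d) ?_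
  have hk0 : (0 : ℝ) < k := NNReal.coe_pos.2 (pos_iff_ne_zero.2 hk)
  have hanti : AntilipschitzWith k⁻¹ f := AntilipschitzWith.of_le_mul_dist fun x y => by
    rw [h, NNReal.coe_inv, inv_mul_cancel_left₀ hk0.ne']
  have h1 := hanti.le_hausdorffMeasure_image (d := d) (Nat.cast_nonneg d) s
  rw [ENNReal.rpow_natCast, ENNReal.coe_inv hk, ← ENNReal.inv_pow] at h1
  have h2 : (k : ENNReal) ^ d * μH[d] s ≤ μH[d] (f '' s) := by
    rw [mul_comm, ← ENNReal.le_div_iff_mul_le (by simp [hk]) (by simp), div_eq_mul_inv, mul_comm]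
    exact h1
  simp_rw [Measure.euclideanHausdorffMeasure_def, Measure.smul_apply, ENNReal.smul_def,
    smul_eq_mul]
  rw [mul_left_comm]
  gcongr

theorem norm_inv_norm_smul_sub_le {E : Type*} [NormedAddCommGroup E] [NormedSpace ℝ E] {c : ℝ}
    (hc : 0 < c) {a b : E} (ha : c ≤ ‖a‖) (hb : c ≤ ‖b‖) :
    ‖‖a‖⁻¹ • a - ‖b‖⁻¹ • b‖ ≤ 2 / c * ‖a - b‖ := by
  have ha0 : 0 < ‖a‖ := hc.trans_le ha
  have hb0 : 0 < ‖b‖ := hc.trans_le hb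
  have h1 : ‖a‖⁻¹ • a - ‖b‖⁻¹ • b = ‖a‖⁻¹ • (a - b) + (‖a‖⁻¹ - ‖b‖⁻¹) • b := by
    rw [smul_sub, sub_smul]; abel
  have h2 : ‖(‖a‖⁻¹ - ‖b‖⁻¹) • b‖ = ‖a‖⁻¹ * |‖b‖ - ‖a‖| := by
    rw [norm_smul, inv_sub_inv ha0.ne' hb0.ne', Real.norm_eq_abs, abs_div,
      abs_of_pos (mul_pos ha0 hb0)]
    field_simp
  have h3 : |‖b‖ - ‖a‖| ≤ ‖a - b‖ := by
    rw [abs_sub_comm]; exact abs_norm_sub_norm_le a b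
  have h4 : ‖a‖⁻¹ ≤ c⁻¹ := by gcongr
  calc ‖‖a‖⁻¹ • a - ‖b‖⁻¹ • b‖ ≤ ‖a‖⁻¹ * ‖a - b‖ + ‖a‖⁻¹ * |‖b‖ - ‖a‖| := by
        rw [h1]
        refine (norm_add_le _ _).trans ?_
        rw [h2, norm_smul, norm_inv, norm_norm]
    _ ≤ c⁻¹ * ‖a - b‖ + c⁻¹ * ‖a - b‖ := by gcongr
    _ = 2 / c * ‖a - b‖ := by ring

/-- Radial projection to the sphere is `2 / x`-Lipschitz on the plane `⟪v, w⟫ = x`, where norms are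
at least `x`. Spherical area is thereby controlled by planar slices, and these by volume through
Fubini. -/
theorem euclideanHausdorffMeasure_le_of_radial {v : E3} (hv : ‖v‖ = 1) {x : ℝ} (hx : 0 < x)
    {T G : Set E3} (hT : ∀ ξ ∈ T, ‖ξ‖ = 1 ∧ 0 < ⟪v, ξ⟫ ∧ (x / ⟪v, ξ⟫) • ξ ∈ G) (d : ℕ) :
    μHE[d] T ≤ ((2 / x).toNNReal : ENNReal) ^ d * μHE[d] (G ∩ {w | ⟪v, w⟫ = x}) := by
  have hlip : LipschitzOnWith (2 / x).toNNReal (fun w : E3 => ‖w‖⁻¹ • w)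
      (G ∩ {w | ⟪v, w⟫ = x}) := by
    have hle : ∀ w ∈ G ∩ {w | ⟪v, w⟫ = x}, x ≤ ‖w‖ := by
      rintro w ⟨-, hw⟩
      have h := real_inner_le_norm v w
      rwa [hv, one_mul, show ⟪v, w⟫ = x from hw] at h
    refine LipschitzOnWith.of_dist_le_mul fun a ha b hb => ?_
    rw [dist_eq_norm, dist_eq_norm, Real.coe_toNNReal _ (by positivity)]
    exact norm_inv_norm_smul_sub_le hx (hle a ha) (hle b hb)
  refine (measure_mono ?_).trans (euclideanHausdorffMeasure_image_le hlip d)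
  intro ξ hξ
  obtain ⟨h1, h2, h3⟩ := hT ξ hξ
  refine ⟨(x / ⟪v, ξ⟫) • ξ, ⟨h3, ?_⟩, ?_⟩
  · change ⟪v, (x / ⟪v, ξ⟫) • ξ⟫ = x
    rw [real_inner_smul_right, div_mul_cancel₀ _ h2.ne']
  · have h4 : 0 < x / ⟪v, ξ⟫ := div_pos hx h2
    simp only [norm_smul, h1, Real.norm_of_nonneg h4.le, mul_one]
    rw [smul_smul, inv_mul_cancel₀ h4.ne', one_smul]

theorem volume_eq_lintegral_slices {v : E3} (hv : ‖v‖ = 1) {G : Set E3} (hG : MeasurableSet G) :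
    volume G = ∫⁻ x : ℝ, μHE[2] (G ∩ {w | ⟪v, w⟫ = x}) := by
  have hv0 : v ≠ 0 := by
    rintro rfl
    simp at hv
  have h := EuclideanGeometry.euclideanHausdorffMeasure_eq_lintegral (0 : E3) hv0 hG
  rw [finrank_euclideanSpace_fin, EuclideanSpace.euclideanHausdorffMeasure_eq_volume] at h
  have hve : ‖v‖ₑ = 1 := by rw [← ofReal_norm, hv, ENNReal.ofReal_one]
  rw [h, hve, one_mul]
  congr with x
  congr 2
  ext w
  simp only [vadd_eq_add, add_zero, SetLike.mem_coe, AffineSubspace.mem_mk', vsub_eq_sub,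
    Submodule.mem_orthogonal_singleton_iff_inner_right, mem_ofPred_eq]
  rw [inner_sub_right, real_inner_smul_right, real_inner_self_eq_norm_sq, hv, one_pow, mul_one,
    sub_eq_zero]

/-- Three squares summing to `1` cannot all be at most `1 / 4`. The resulting six caps keep the
radial projection away from directions parallel to the slicing planes. -/
theorem exists_basisFun_smul_inner_ge {ξ : E3} (hξ : ‖ξ‖ = 1) :
    ∃ i : Fin 3, ∃ ε ∈ ({1, -1} : Finset ℝ),
      1 / 2 ≤ ⟪ε • (EuclideanSpace.basisFun (Fin 3) ℝ i : E3), ξ⟫ := by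
  by_contra! h
  have h1 : ∀ i, ξ i ^ 2 ≤ 1 / 4 := by
    intro i
    have ha := h i 1 (by simp)
    have hb := h i (-1) (by simp)
    rw [real_inner_smul_left, EuclideanSpace.basisFun_inner] at ha hb
    nlinarith
  have h2 := EuclideanSpace.real_norm_sq_eq ξ
  rw [hξ, Fin.sum_univ_three] at h2
  linarith [h1 0, h1 1, h1 2]

theorem norm_smul_basisFun {i : Fin 3} {ε : ℝ} (hε : ε ∈ ({1, -1} : Finset ℝ)) :
    ‖ε • (EuclideanSpace.basisFun (Fin 3) ℝ i : E3)‖ = 1 := by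
  rw [norm_smul, OrthonormalBasis.norm_eq_one, mul_one]
  rcases Finset.mem_insert.1 hε with rfl | h
  · simp
  · rw [Finset.mem_singleton.1 h]; simp

theorem sphere_subset_iUnion_caps :
    sphere (0 : E3) 1 ⊆ ⋃ i : Fin 3, ⋃ ε ∈ ({1, -1} : Finset ℝ),
      {ξ | ‖ξ‖ = 1 ∧ 1 / 2 ≤ ⟪ε • (EuclideanSpace.basisFun (Fin 3) ℝ i : E3), ξ⟫} := by
  intro ξ hξ
  have hξ1 : ‖ξ‖ = 1 := mem_sphere_zero_iff_norm.1 hξ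
  obtain ⟨i, ε, hε, h⟩ := exists_basisFun_smul_inner_ge hξ1
  simp only [mem_iUnion]
  exact ⟨i, ε, hε, hξ1, h⟩

theorem exists_slice_lt_top {v : E3} (hv : ‖v‖ = 1) {G : Set E3} (hG : MeasurableSet G)
    (hG' : volume G < ⊤) : ∃ x ∈ Ioo (0 : ℝ) 1, μHE[2] (G ∩ {w | ⟪v, w⟫ = x}) < ⊤ := by
  by_contra! h
  rw [volume_eq_lintegral_slices hv hG] at hG'
  have h1 : ∫⁻ _ in Ioo (0 : ℝ) 1, (⊤ : ENNReal) ≤ ∫⁻ x : ℝ, μHE[2] (G ∩ {w | ⟪v, w⟫ = x}) :=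
    (setLIntegral_mono' measurableSet_Ioo h).trans (setLIntegral_le_lintegral _ _)
  rw [setLIntegral_const, Real.volume_Ioo] at h1
  simp only [sub_zero, ENNReal.ofReal_one, mul_one] at h1
  exact absurd hG' (not_lt.2 h1)

theorem euclideanHausdorffMeasure_unitSphere_lt_top : μHE[2] (sphere (0 : E3) 1) < ⊤ := by
  refine (measure_mono sphere_subset_iUnion_caps).trans_lt ?_
  refine (measure_iUnion_fintype_le _ _).trans_lt (ENNReal.sum_lt_top.2 fun i _ => ?_)
  refine (measure_biUnion_finset_le _ _).trans_lt (ENNReal.sum_lt_top.2 fun ε hε => ?_)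
  have hv := norm_smul_basisFun (i := i) hε
  set v : E3 := ε • (EuclideanSpace.basisFun (Fin 3) ℝ i : E3)
  -- Radius `2` suffices: on the cap `⟪v, ξ⟫ ≥ 1 / 2`, so the lifted point has norm `x / ⟪v, ξ⟫ ≤ 2
  -- x < 2`.
  obtain ⟨x, hx, hfin⟩ := exists_slice_lt_top hv (isClosed_closedBall (x := (0 : E3))
    (ε := 2)).measurableSet measure_closedBall_lt_top
  refine (euclideanHausdorffMeasure_le_of_radial (G := closedBall 0 2) hv hx.1 ?_ 2).trans_lt
    (ENNReal.mul_lt_top (by simp) hfin)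
  rintro ξ ⟨h1, h2⟩
  have h3 : 0 < ⟪v, ξ⟫ := by linarith
  refine ⟨h1, h3, ?_⟩
  rw [mem_closedBall_zero_iff, norm_smul, h1, mul_one, Real.norm_of_nonneg (div_pos hx.1 h3).le,
    div_le_iff₀ h3]
  linarith [hx.2]

open scoped Pointwise in
/-- A Lebesgue null cone meets the unit sphere in a set of zero area. -/
theorem euclideanHausdorffMeasure_unitSphere_inter_cone {F : Set E3} (hF : MeasurableSet F)
    (hF0 : volume F = 0) (hcone : ∀ c : ℝ, 0 < c → ∀ w ∈ F, c • w ∈ F) :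
    μHE[2] (sphere (0 : E3) 1 ∩ F) = 0 := by
  have hslice : ∀ v : E3, ‖v‖ = 1 → μHE[2] (F ∩ {w | ⟪v, w⟫ = 1}) = 0 := by
    intro v hv
    rw [volume_eq_lintegral_slices hv hF] at hF0
    -- The slice at height `x` contains the slice at height `1` dilated by `x > 1`, so its area is
    -- at least as large; yet the slice areas integrate to zero.
    have hle : ∀ x ∈ Ioo (1 : ℝ) 2,
        μHE[2] (F ∩ {w | ⟪v, w⟫ = 1}) ≤ μHE[2] (F ∩ {w | ⟪v, w⟫ = x}) := by
      intro x hx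
      have hx0 : (0 : ℝ) < x := one_pos.trans hx.1
      have hsub : x • (F ∩ {w | ⟪v, w⟫ = 1}) ⊆ F ∩ {w | ⟪v, w⟫ = x} := by
        rintro _ ⟨w, ⟨hw1, hw2⟩, rfl⟩
        have hw2 : ⟪v, w⟫ = 1 := hw2
        refine ⟨hcone x hx0 w hw1, ?_⟩
        change ⟪v, x • w⟫ = x
        rw [real_inner_smul_right, hw2, mul_one]
      refine le_trans ?_ (measure_mono hsub)
      rw [Measure.euclideanHausdorffMeasure_smul₀ 2 hx0.ne', ENNReal.smul_def, smul_eq_mul]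
      refine le_mul_of_one_le_left (zero_le) ?_
      rw [ENNReal.coe_pow]
      refine one_le_pow₀ ?_
      rw [ENNReal.one_le_coe_iff, ← NNReal.coe_le_coe, coe_nnnorm, Real.norm_of_nonneg hx0.le]
      exact hx.1.le
    have h1 : ∫⁻ _ in Ioo (1 : ℝ) 2, μHE[2] (F ∩ {w | ⟪v, w⟫ = 1}) ≤
        ∫⁻ x : ℝ, μHE[2] (F ∩ {w | ⟪v, w⟫ = x}) :=
      (setLIntegral_mono' measurableSet_Ioo hle).trans (setLIntegral_le_lintegral _ _)
    rw [setLIntegral_const, Real.volume_Ioo, hF0] at h1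
    norm_num at h1
    exact h1
  have hsub : sphere (0 : E3) 1 ∩ F ⊆ ⋃ i : Fin 3, ⋃ ε ∈ ({1, -1} : Finset ℝ),
      {ξ | ‖ξ‖ = 1 ∧ 1 / 2 ≤ ⟪ε • (EuclideanSpace.basisFun (Fin 3) ℝ i : E3), ξ⟫} ∩ F := by
    simp_rw [← iUnion_inter]
    exact inter_subset_inter_left _ sphere_subset_iUnion_caps
  refine measure_mono_null hsub ?_
  rw [measure_iUnion_null_iff]
  intro i
  refine (measure_biUnion_null_iff (Finset.countable_toSet ({1, -1} : Finset ℝ))).2 fun ε hε => ?_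
  have hv := norm_smul_basisFun (i := i) hε
  set v : E3 := ε • (EuclideanSpace.basisFun (Fin 3) ℝ i : E3)
  refine le_antisymm ?_ (zero_le)
  refine (euclideanHausdorffMeasure_le_of_radial (G := F) hv one_pos ?_ 2).trans ?_
  · rintro ξ ⟨⟨h1, h2⟩, h4⟩
    have h3 : 0 < ⟪v, ξ⟫ := by linarith
    exact ⟨h1, h3, hcone _ (by positivity) _ h4⟩
  · rw [hslice v hv, mul_zero]

theorem convex_normalCone (C : Set E3) (p : E3) : Convex ℝ (normalCone C p) := by
  intro ξ hξ η hη a b ha hb _ x hx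
  rw [inner_add_left, real_inner_smul_left, real_inner_smul_left]
  nlinarith [mul_nonneg ha (neg_nonneg.2 (hξ x hx)), mul_nonneg hb (neg_nonneg.2 (hη x hx))]

theorem smul_mem_normalCone {C : Set E3} {p : E3} {c : ℝ} (hc : 0 < c) {ξ : E3} :
    c • ξ ∈ normalCone C p ↔ ξ ∈ normalCone C p := by
  refine forall₂_congr fun x _ => ?_
  rw [real_inner_smul_left, ← not_lt, ← not_lt, mul_pos_iff_of_pos_left hc]

/-- The boundary of a convex set is Lebesgue null, and positive dilations preserve the normal cone,
hence its boundary. -/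
theorem euclideanHausdorffMeasure_frontier_normalCone (C : Set E3) (p : E3) :
    μHE[2] (sphere (0 : E3) 1 ∩ frontier (normalCone C p)) = 0 := by
  refine euclideanHausdorffMeasure_unitSphere_inter_cone isClosed_frontier.measurableSet
    ((convex_normalCone C p).addHaar_frontier volume) fun c hc w hw => ?_
  have h := (Homeomorph.smulOfNeZero c hc.ne').preimage_frontier (normalCone C p)
  have h2 : (Homeomorph.smulOfNeZero c hc.ne') ⁻¹' normalCone C p = normalCone C p := by
    ext ξ
    exact smul_mem_normalCone hc
  rw [h2] at h
  rw [← h] at hw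
  exact hw

/-! ### Change of variables and evaluation of the currents -/

theorem dist_pair_of_dist_eq {m m' ξ ξ' : E3} {a b : ℝ} {x y : E3}
    (h1 : dist m m' = a * dist x y) (h2 : dist ξ ξ' = b * dist x y) :
    dist (pair m ξ) (pair m' ξ') = √(a ^ 2 + b ^ 2) * dist x y := by
  rw [WithLp.prod_dist_eq_of_L2]
  change √(dist m m' ^ 2 + dist ξ ξ' ^ 2) = _
  rw [h1, h2, mul_pow, mul_pow, ← add_mul, Real.sqrt_mul (by positivity),
    Real.sqrt_sq dist_nonneg]

theorem restrict_image_euclideanHausdorffMeasure {X Y : Type*} [MetricSpace X]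
    [MeasurableSpace X] [BorelSpace X] [MetricSpace Y] [MeasurableSpace Y] [BorelSpace Y]
    {k : NNReal} (hk : k ≠ 0) {f : X → Y} (hf : Measurable f)
    (h : ∀ x y, dist (f x) (f y) = k * dist x y) (d : ℕ) (s : Set X) :
    (μHE[d] : Measure Y).restrict (f '' s) =
      (k ^ d) • ((μHE[d] : Measure X).restrict s).map f := by
  ext t ht
  rw [Measure.restrict_apply ht, Measure.smul_apply, Measure.map_apply hf ht,
    Measure.restrict_apply (hf ht), ← image_preimage_inter,
    euclideanHausdorffMeasure_image_of_dist_eq hk h, ENNReal.smul_def, smul_eq_mul,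
    ENNReal.coe_pow]

/-- Completeness makes the similarity a closed embedding, hence a measurable one, so neither `s` nor
`g` has to be measurable. -/
theorem setIntegral_image_euclideanHausdorffMeasure {X Y : Type*} [MetricSpace X]
    [CompleteSpace X] [MeasurableSpace X] [BorelSpace X] [MetricSpace Y] [MeasurableSpace Y]
    [BorelSpace Y] {k : NNReal} (hk : k ≠ 0) {f : X → Y}
    (h : ∀ x y, dist (f x) (f y) = k * dist x y) (d : ℕ) (s : Set X) (g : Y → ℝ) :
    ∫ y in f '' s, g y ∂μHE[d] = (k : ℝ) ^ d * ∫ x in s, g (f x) ∂μHE[d] := by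
  have hk0 : (0 : ℝ) < k := NNReal.coe_pos.2 (pos_iff_ne_zero.2 hk)
  have hanti : AntilipschitzWith k⁻¹ f := AntilipschitzWith.of_le_mul_dist fun x y => by
    rw [h, NNReal.coe_inv, inv_mul_cancel_left₀ hk0.ne']
  have hlip : LipschitzWith k f := LipschitzWith.of_dist_le_mul fun x y => (h x y).le
  have hemb := (hanti.isClosedEmbedding hlip.uniformContinuous).measurableEmbedding
  rw [restrict_image_euclideanHausdorffMeasure hk hemb.measurable h, integral_smul_nnreal_measure,
    hemb.integral_map, NNReal.smul_def, NNReal.coe_pow, smul_eq_mul]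

theorem measurableSet_unitNormals (C : Set E3) : MeasurableSet (unitNormals C) := by
  have hfst : Continuous fun z : TE3 => z.fst := (WithLp.fstL 2 ℝ E3 E3).continuous
  have hsnd : Continuous fun z : TE3 => z.snd := (WithLp.sndL 2 ℝ E3 E3).continuous
  have h : unitNormals C = {z | z.fst ∈ frontier C} ∩ ({z | ‖z.snd‖ = 1} ∩
      ⋂ x ∈ C, {z | ⟪z.snd, x - z.fst⟫ ≤ 0}) := by
    ext z
    simp [unitNormals]
  rw [h]
  refine IsClosed.measurableSet ((isClosed_frontier.preimage hfst).inter
    ((isClosed_eq hsnd.norm continuous_const).inter ?_))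
  exact isClosed_biInter fun x _ =>
    isClosed_le (hsnd.inner (continuous_const.sub hfst)) continuous_const

theorem measurableSet_above {B : Set E3} (hB : MeasurableSet B) : MeasurableSet (above B) :=
  (WithLp.fstL 2 ℝ E3 E3).continuous.measurable hB

theorem integrationCurrent_restrictForm {S : Set TE3} {B : Set E3} (hB : MeasurableSet B)
    {φ : Form2} {f : TE3 → ℝ}
    (h : ∀ᵐ z ∂(μHE[2] : Measure TE3).restrict (S ∩ above B), φ z (frame S z) = f z) :
    integrationCurrent S (restrictForm B φ) = ∫ z in S ∩ above B, f z ∂μHE[2] := by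
  have h1 : ∀ z, restrictForm B φ z (frame S z) =
      (above B).indicator (fun z => φ z (frame S z)) z := by
    intro z
    by_cases hz : z ∈ above B <;> simp [restrictForm, hz]
  rw [integrationCurrent, funext h1, setIntegral_indicator (measurableSet_above hB)]
  exact integral_congr_ae h

theorem integrationCurrent_omega {S : Set TE3} {B : Set E3} (hB : MeasurableSet B) {a : ℝ}
    (ha : 0 ≤ a) (h : ∀ᵐ z ∂(μHE[2] : Measure TE3).restrict (S ∩ above B),
      ‖z.snd‖ = 1 ∧ tangentConeAt ℝ S z = sheetTangent a z.snd) (X Y : E3) :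
    integrationCurrent S (restrictForm B (omega X Y)) = ∫ z in S ∩ above B,
      a * (1 + a ^ 2)⁻¹ * (⟪X, Y⟫ - ⟪X, z.snd⟫ * ⟪Y, z.snd⟫) ∂μHE[2] := by
  refine integrationCurrent_restrictForm hB ?_
  filter_upwards [h] with z hz
  exact omega_apply_positiveFrame ha hz.1 hz.2
    (isPositiveFrame_frame (exists_isPositiveFrame ha hz.1 hz.2)) X Y

theorem integrationCurrent_omegaTilde {S : Set TE3} {B : Set E3} (hB : MeasurableSet B) {a : ℝ}
    (ha : 0 ≤ a) (h : ∀ᵐ z ∂(μHE[2] : Measure TE3).restrict (S ∩ above B),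
      ‖z.snd‖ = 1 ∧ tangentConeAt ℝ S z = sheetTangent a z.snd) (X Y : E3) :
    integrationCurrent S (restrictForm B (omegaTilde X Y)) = ∫ z in S ∩ above B,
      a * (1 + a ^ 2)⁻¹ * (⟪X, Y⟫ - ⟪X, z.snd⟫ * ⟪Y, z.snd⟫) ∂μHE[2] := by
  refine integrationCurrent_restrictForm hB ?_
  filter_upwards [h] with z hz
  exact omegaTilde_apply_positiveFrame ha hz.1 hz.2
    (isPositiveFrame_frame (exists_isPositiveFrame ha hz.1 hz.2)) X Y

/-! ### The curvature measures of a ball -/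

theorem euclideanHausdorffMeasure_sphere_lt_top (A : E3) {r : ℝ} (hr : 0 < r) :
    μHE[2] (sphere A r) < ⊤ := by
  have h : sphere A r ⊆ (fun w => A + r • w) '' sphere (0 : E3) 1 := by
    intro p hp
    refine ⟨r⁻¹ • (p - A), ?_, ?_⟩
    · rw [mem_sphere_zero_iff_norm, norm_smul, mem_sphere_iff_norm.1 hp, norm_inv,
        Real.norm_of_nonneg hr.le, inv_mul_cancel₀ hr.ne']
    · simp [smul_smul, mul_inv_cancel₀ hr.ne']
  refine (measure_mono h).trans_lt ((euclideanHausdorffMeasure_image_le (K := r.toNNReal)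
    (LipschitzOnWith.of_dist_le_mul fun x _ y _ => ?_) 2).trans_lt
    (ENNReal.mul_lt_top (by simp) euclideanHausdorffMeasure_unitSphere_lt_top))
  rw [dist_add_left, dist_smul₀, Real.norm_of_nonneg hr.le, Real.coe_toNNReal _ hr.le]

theorem integrableOn_sphere_of_continuous (A : E3) {r : ℝ} (hr : 0 < r) {f : E3 → ℝ}
    (hf : Continuous f) (B : Set E3) : IntegrableOn f (B ∩ sphere A r) μHE[2] := by
  obtain ⟨M, hM⟩ := (isCompact_sphere A r).exists_bound_of_continuousOn hf.continuousOn
  have h : IntegrableOn f (sphere A r) μHE[2] :=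
    Measure.integrableOn_of_bounded (euclideanHausdorffMeasure_sphere_lt_top A hr).ne
      hf.aestronglyMeasurable ((ae_restrict_iff' isClosed_sphere.measurableSet).2
        (Filter.Eventually.of_forall hM))
  exact h.mono_set inter_subset_right

theorem continuous_ballNormal (A : E3) (r : ℝ) : Continuous (ballNormal A r) := by
  unfold ballNormal
  fun_prop

/-- The parametrization of the unit normals of a ball by its boundary. -/
def ballGauss (A : E3) (r : ℝ) (p : E3) : TE3 := pair p (ballNormal A r p)

theorem dist_ballGauss (A : E3) {r : ℝ} (hr : 0 < r) (p q : E3) :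
    dist (ballGauss A r p) (ballGauss A r q) = √(1 ^ 2 + r⁻¹ ^ 2) * dist p q := by
  refine dist_pair_of_dist_eq (one_mul _).symm ?_
  rw [ballNormal, ballNormal, dist_smul₀, dist_sub_right, norm_inv, Real.norm_of_nonneg hr.le]

theorem unitNormals_closedBall_inter_above (A : E3) {r : ℝ} (hr : 0 < r) (B : Set E3) :
    unitNormals (closedBall A r) ∩ above B = ballGauss A r '' (B ∩ sphere A r) := by
  rw [unitNormals_closedBall hr]
  ext z
  constructor
  · rintro ⟨⟨h1, h2⟩, h3⟩
    have h4 : z.fst - A = r • z.snd := by rw [h1, add_sub_cancel_left]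
    refine ⟨z.fst, ⟨h3, ?_⟩, ?_⟩
    · rw [mem_sphere_iff_norm, h4, norm_smul, h2, mul_one, Real.norm_of_nonneg hr.le]
    · refine WithLp.ofLp_injective 2 (Prod.ext rfl ?_)
      change r⁻¹ • (z.fst - A) = z.snd
      rw [h4, smul_smul, inv_mul_cancel₀ hr.ne', one_smul]
  · rintro ⟨p, ⟨hpB, hp⟩, rfl⟩
    refine ⟨⟨?_, ?_⟩, hpB⟩
    · change p = A + r • r⁻¹ • (p - A)
      rw [smul_smul, mul_inv_cancel₀ hr.ne', one_smul, add_sub_cancel]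
    · change ‖r⁻¹ • (p - A)‖ = 1
      rw [norm_smul, mem_sphere_iff_norm.1 hp, norm_inv, Real.norm_of_nonneg hr.le,
        inv_mul_cancel₀ hr.ne']

theorem ae_unitNormals_closedBall (A : E3) {r : ℝ} (hr : 0 < r) {B : Set E3}
    (hB : MeasurableSet B) :
    ∀ᵐ z ∂(μHE[2] : Measure TE3).restrict (unitNormals (closedBall A r) ∩ above B),
      ‖z.snd‖ = 1 ∧ tangentConeAt ℝ (unitNormals (closedBall A r)) z = sheetTangent r z.snd := by
  filter_upwards [ae_restrict_mem ((measurableSet_unitNormals _).inter (measurableSet_above hB))]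
    with z hz
  refine ⟨hz.1.2.1, ?_⟩
  rw [unitNormals_closedBall hr] at hz ⊢
  exact tangentConeAt_sheet hz.1

/-- The Jacobian of `ballGauss` is `1 + r⁻²`, and `(1 + r⁻²) * r / (1 + r²) = 1 / r`. -/
theorem setIntegral_unitNormals_closedBall (A : E3) {r : ℝ} (hr : 0 < r) (B : Set E3)
    (X Y : E3) :
    ∫ z in unitNormals (closedBall A r) ∩ above B,
      r * (1 + r ^ 2)⁻¹ * (⟪X, Y⟫ - ⟪X, z.snd⟫ * ⟪Y, z.snd⟫) ∂μHE[2] =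
    ∫ p in B ∩ sphere A r,
      1 / r * (⟪X, Y⟫ - ⟪X, ballNormal A r p⟫ * ⟪Y, ballNormal A r p⟫) ∂μHE[2] := by
  have hk0 : 0 < √(1 ^ 2 + r⁻¹ ^ 2) := by positivity
  rw [unitNormals_closedBall_inter_above A hr,
    setIntegral_image_euclideanHausdorffMeasure (k := ⟨√(1 ^ 2 + r⁻¹ ^ 2), hk0.le⟩)
      (fun h => hk0.ne' (congrArg NNReal.toReal h)) (dist_ballGauss A hr), ← integral_const_mul]
  congr with p
  change √(1 ^ 2 + r⁻¹ ^ 2) ^ 2 * (r * (1 + r ^ 2)⁻¹ *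
    (⟪X, Y⟫ - ⟪X, ballNormal A r p⟫ * ⟪Y, ballNormal A r p⟫)) = _
  rw [Real.sq_sqrt (by positivity)]
  field_simp
  ring

theorem dotProduct_ballMatrix_mulVec (A : E3) {r : ℝ} (hr : 0 < r) (B : Set E3) (X Y : E3) :
    WithLp.ofLp X ⬝ᵥ (ballMatrix A r B).mulVec (WithLp.ofLp Y) =
    ∫ p in B ∩ sphere A r,
      1 / r * (⟪X, Y⟫ - ⟪X, ballNormal A r p⟫ * ⟪Y, ballNormal A r p⟫) ∂μHE[2] := by
  have hcoord : ∀ i, Continuous fun p => ballNormal A r p i := fun i =>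
    (EuclideanSpace.proj (𝕜 := ℝ) i).continuous.comp (continuous_ballNormal A r)
  have hint : ∀ i j, IntegrableOn (fun p => 1 / r * ((1 : Matrix (Fin 3) (Fin 3) ℝ) i j -
      ballNormal A r p i * ballNormal A r p j)) (B ∩ sphere A r) μHE[2] := fun i j =>
    integrableOn_sphere_of_continuous A hr
      (continuous_const.mul (continuous_const.sub ((hcoord i).mul (hcoord j)))) B
  have hM : ∀ i j, ballMatrix A r B i j = ∫ p in B ∩ sphere A r,
      1 / r * ((1 : Matrix (Fin 3) (Fin 3) ℝ) i j -
        ballNormal A r p i * ballNormal A r p j) ∂μHE[2] := by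
    intro i j
    rw [← frontier_closedBall A hr.ne']
    rfl
  simp only [dotProduct, Matrix.mulVec, hM, Finset.mul_sum]
  simp_rw [← integral_mul_const, ← integral_const_mul]
  have h2 : ∀ i j, IntegrableOn (fun p => X i * (1 / r * ((1 : Matrix (Fin 3) (Fin 3) ℝ) i j -
      ballNormal A r p i * ballNormal A r p j) * Y j)) (B ∩ sphere A r) μHE[2] := fun i j =>
    ((hint i j).mul_const _).const_mul _
  have h3 : ∀ i, ∑ j, ∫ p in B ∩ sphere A r, X i * (1 / r * ((1 : Matrix (Fin 3) (Fin 3) ℝ) i j -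
      ballNormal A r p i * ballNormal A r p j) * Y j) ∂μHE[2] = ∫ p in B ∩ sphere A r,
      ∑ j, X i * (1 / r * ((1 : Matrix (Fin 3) (Fin 3) ℝ) i j -
      ballNormal A r p i * ballNormal A r p j) * Y j) ∂μHE[2] := fun i =>
    (integral_finsetSum _ fun j _ => h2 i j).symm
  rw [Finset.sum_congr rfl fun i _ => h3 i,
    ← integral_finsetSum _ fun i _ => integrable_finsetSum _ fun j _ => h2 i j]
  congr with p
  simp only [inner_eq_sum_coords, Fin.sum_univ_three, Matrix.one_apply]
  simp
  ring

theorem normalCycle_singleton (C : Set E3) (φ : Form2) :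
    normalCycle ![C] φ = integrationCurrent (unitNormals C) φ := by
  have h : nonemptySubsets 1 = {{0}} := by decide
  rw [normalCycle, h, Finset.sum_singleton]
  simp

theorem isRepresentableAbove_closedBall (A : E3) {r : ℝ} (hr : 0 < r) {B : Set E3}
    (hB : MeasurableSet B) : IsRepresentableAbove ![closedBall A r] B := by
  have h : nonemptySubsets 1 = {{0}} := by decide
  intro I hI
  rw [h, Finset.mem_singleton] at hI
  subst hI
  have hC : ⋂ i ∈ ({0} : Finset (Fin 1)), ![closedBall A r] i = closedBall A r := by simp
  rw [hC]
  refine ⟨?_, ?_⟩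
  · have hk0 : 0 < √(1 ^ 2 + r⁻¹ ^ 2) := by positivity
    rw [unitNormals_closedBall_inter_above A hr,
      euclideanHausdorffMeasure_image_of_dist_eq (k := ⟨√(1 ^ 2 + r⁻¹ ^ 2), hk0.le⟩)
        (fun h => hk0.ne' (congrArg NNReal.toReal h)) (dist_ballGauss A hr)]
    exact ENNReal.mul_lt_top (ENNReal.pow_lt_top ENNReal.coe_lt_top) ((measure_mono inter_subset_right).trans_lt
      (euclideanHausdorffMeasure_sphere_lt_top A hr))
  · filter_upwards [ae_unitNormals_closedBall A hr hB] with z hz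
    exact exists_isPositiveFrame hr.le hz.1 hz.2

/-! ### Vanishing above a common boundary point -/

theorem isometry_pair (p : E3) : Isometry (pair p) := by
  refine Isometry.of_dist_eq fun x y => ?_
  rw [dist_pair_of_dist_eq (a := 0) (b := 1) (x := x) (y := y) (by simp) (by simp)]
  simp

theorem euclideanHausdorffMeasure_unitNormals_above_singleton (C : Set E3) (p : E3) :
    μHE[2] (unitNormals C ∩ above {p}) < ⊤ := by
  have h : unitNormals C ∩ above {p} ⊆ pair p '' sphere (0 : E3) 1 := by
    rintro z ⟨⟨-, h2, -⟩, h4⟩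
    exact ⟨z.snd, mem_sphere_zero_iff_norm.2 h2,
      WithLp.ofLp_injective 2 (Prod.ext (Eq.symm h4) rfl)⟩
  refine (measure_mono h).trans_lt ?_
  rw [(isometry_pair p).euclideanHausdorffMeasure_image]
  exact euclideanHausdorffMeasure_unitSphere_lt_top

/-- Above `p` the fibre is an isometric copy of the unit vectors in the normal cone; the exceptional
ones lie on its boundary and have zero area. -/
theorem ae_unitNormals_above_singleton {C : Set E3} (hC : IsClosed C) {p : E3}
    (hp : p ∈ frontier C) :
    ∀ᵐ z ∂(μHE[2] : Measure TE3).restrict (unitNormals C ∩ above {p}),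
      ‖z.snd‖ = 1 ∧ tangentConeAt ℝ (unitNormals C) z = sheetTangent 0 z.snd := by
  have hnull : ∀ᵐ z ∂(μHE[2] : Measure TE3).restrict (unitNormals C ∩ above {p}),
      z ∉ pair p '' (sphere (0 : E3) 1 ∩ frontier (normalCone C p)) := by
    refine ae_restrict_of_ae (measure_eq_zero_iff_ae_notMem.1 ?_)
    rw [(isometry_pair p).euclideanHausdorffMeasure_image,
      euclideanHausdorffMeasure_frontier_normalCone]
  filter_upwards [hnull, ae_restrict_mem ((measurableSet_unitNormals C).inter
    (measurableSet_above (measurableSet_singleton p)))] with z hz1 hz2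
  obtain ⟨⟨-, h2, h3⟩, h4⟩ := id hz2
  have h4 : z.fst = p := h4
  rw [h4] at h3
  refine ⟨h2, tangentConeAt_unitNormals_of_mem_interior hC hp hz2.1 ?_⟩
  by_contra hint
  exact hz1 ⟨z.snd, ⟨mem_sphere_zero_iff_norm.2 h2, subset_closure h3, hint⟩,
    WithLp.ofLp_injective 2 (Prod.ext h4.symm rfl)⟩

theorem isRepresentableAbove_singleton {n : ℕ} {C : Fin n → Set E3} {p : E3}
    (hC : ∀ I : Finset (Fin n), I.Nonempty →
      IsClosed (⋂ i ∈ I, C i) ∧ p ∈ frontier (⋂ i ∈ I, C i)) : IsRepresentableAbove C {p} := by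
  intro I hI
  obtain ⟨h1, h2⟩ := hC I (by simpa [nonemptySubsets] using hI)
  refine ⟨euclideanHausdorffMeasure_unitNormals_above_singleton _ p, ?_⟩
  filter_upwards [ae_unitNormals_above_singleton h1 h2] with z hz
  exact exists_isPositiveFrame le_rfl hz.1 hz.2

theorem anisotropicH_singleton {n : ℕ} {C : Fin n → Set E3} {p : E3}
    (hC : ∀ I : Finset (Fin n), I.Nonempty →
      IsClosed (⋂ i ∈ I, C i) ∧ p ∈ frontier (⋂ i ∈ I, C i)) (X Y : E3) :
    anisotropicH C {p} X Y = 0 := by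
  rw [anisotropicH, normalCycle]
  refine Finset.sum_eq_zero fun I hI => ?_
  obtain ⟨h1, h2⟩ := hC I (by simpa [nonemptySubsets] using hI)
  -- Here `a = 0`, so the factor `a / (1 + a²)` annihilates the integrand.
  rw [integrationCurrent_omega (measurableSet_singleton p) le_rfl
    (ae_unitNormals_above_singleton h1 h2)]
  simp

theorem anisotropicHTilde_singleton {n : ℕ} {C : Fin n → Set E3} {p : E3}
    (hC : ∀ I : Finset (Fin n), I.Nonempty →
      IsClosed (⋂ i ∈ I, C i) ∧ p ∈ frontier (⋂ i ∈ I, C i)) (X Y : E3) :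
    anisotropicHTilde C {p} X Y = 0 := by
  rw [anisotropicHTilde, normalCycle]
  refine Finset.sum_eq_zero fun I hI => ?_
  obtain ⟨h1, h2⟩ := hC I (by simpa [nonemptySubsets] using hI)
  rw [integrationCurrent_omegaTilde (measurableSet_singleton p) le_rfl
    (ae_unitNormals_above_singleton h1 h2)]
  simp

theorem mem_frontier_biInter {α ι : Type*} [TopologicalSpace α] {C : ι → Set α}
    (hC : ∀ i, IsClosed (C i)) {p : α} (hp : ∀ i, p ∈ frontier (C i)) {I : Finset ι}
    (hI : I.Nonempty) :
    IsClosed (⋂ i ∈ I, C i) ∧ p ∈ frontier (⋂ i ∈ I, C i) := by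
  have hcl : IsClosed (⋂ i ∈ I, C i) := isClosed_biInter fun i _ => hC i
  obtain ⟨i, hi⟩ := hI
  refine ⟨hcl, subset_closure (mem_iInter₂.2 fun j _ => (hC j).frontier_subset (hp j)),
    fun h => (hp i).2 (interior_mono (biInter_subset_of_mem hi) h)⟩

end NormalCycle

end

theorem mainTheorem11 :
    (∀ (A : NormalCycle.E3) (r : ℝ), 0 < r → ∀ B : Set NormalCycle.E3, MeasurableSet B →
      NormalCycle.IsRepresentableAbove ![closedBall A r] B ∧
      ∀ X Y : NormalCycle.E3,
        NormalCycle.anisotropicH ![closedBall A r] B X Y =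
          WithLp.ofLp X ⬝ᵥ (NormalCycle.ballMatrix A r B).mulVec (WithLp.ofLp Y) ∧
        NormalCycle.anisotropicHTilde ![closedBall A r] B X Y =
          WithLp.ofLp X ⬝ᵥ (NormalCycle.ballMatrix A r B).mulVec (WithLp.ofLp Y)) ∧
    (∀ (A₁ A₂ A₃ p : NormalCycle.E3) (r : ℝ), 0 < r →
      p ∈ frontier (closedBall A₁ r) ∩ frontier (closedBall A₂ r) ∩ frontier (closedBall A₃ r) →
      NormalCycle.IsRepresentableAbove
        ![closedBall A₁ r, closedBall A₂ r, closedBall A₃ r] {p} ∧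
      ∀ X Y : NormalCycle.E3,
        NormalCycle.anisotropicH
          ![closedBall A₁ r, closedBall A₂ r, closedBall A₃ r] {p} X Y = 0 ∧
        NormalCycle.anisotropicHTilde
          ![closedBall A₁ r, closedBall A₂ r, closedBall A₃ r] {p} X Y = 0) := by
  refine ⟨fun A r hr B hB => ⟨NormalCycle.isRepresentableAbove_closedBall A hr hB,
    fun X Y => ⟨?_, ?_⟩⟩, fun A₁ A₂ A₃ p r hr hp => ?_⟩
  · rw [NormalCycle.anisotropicH, NormalCycle.normalCycle_singleton,
      NormalCycle.integrationCurrent_omega hB hr.le (NormalCycle.ae_unitNormals_closedBall A hr hB),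
      NormalCycle.setIntegral_unitNormals_closedBall A hr,
      NormalCycle.dotProduct_ballMatrix_mulVec A hr]
  · rw [NormalCycle.anisotropicHTilde, NormalCycle.normalCycle_singleton,
      NormalCycle.integrationCurrent_omegaTilde hB hr.le
        (NormalCycle.ae_unitNormals_closedBall A hr hB),
      NormalCycle.setIntegral_unitNormals_closedBall A hr,
      NormalCycle.dotProduct_ballMatrix_mulVec A hr]
  · have hC : ∀ i, IsClosed (![closedBall A₁ r, closedBall A₂ r, closedBall A₃ r] i) ∧
        p ∈ frontier (![closedBall A₁ r, closedBall A₂ r, closedBall A₃ r] i) := by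
      intro i
      fin_cases i
      · exact ⟨isClosed_closedBall, hp.1.1⟩
      · exact ⟨isClosed_closedBall, hp.1.2⟩
      · exact ⟨isClosed_closedBall, hp.2⟩
    have hI := fun (I : Finset (Fin 3)) (h : I.Nonempty) =>
      NormalCycle.mem_frontier_biInter (fun i => (hC i).1) (fun i => (hC i).2) h
    exact ⟨NormalCycle.isRepresentableAbove_singleton hI, fun X Y =>
      ⟨NormalCycle.anisotropicH_singleton hI X Y, NormalCycle.anisotropicHTilde_singleton hI X Y⟩⟩
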